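/- Let $K$ be a field, and let $K_0(\mathcal V_K)$ be the Grothendieck ring of varieties over $K$ (separated $K$-schemes of finite type): it is generated by isomorphism classes $[X]$, with relations $[X]=[Y]+[X\smallsetminus Y]$ for closed subvarieties $Y\subset X$, and with product $[X]\cdot[Y]=[X\times_K Y]$. Put $\mathbb L=[\mathbb A^1]$ and $\mathbb T=\mathbb L-1$. For a graph $G$ with finitely many edges (loops, multiple edges and disconnected graphs are allowed) let $\Psi_G=\sum_F\prod_{e\notin F}t_e$ be its Kirchhoff--Symanzik polynomial, the sum being over the maximal spanning forests $F$ of $G$ (the spanning trees, if $G$ is connected), and let $\mathbb U(G)=[\mathbb A^{E(G)}\smallsetminus\{\Psi_G=0\}]\in K_0(\mathcal V_K)$. Let $e$ be any edge of $G$. The $(1,3,1)$-bananification of an edge with ends $x,y$ replaces it by a string formed by an edge from $x$ to a new vertex $u$, three parallel edges from $u$ to a new vertex $v$, and an edge from $v$ to $y$. Let $G_0=G$, let $G_1$ be the $(1,3,1)$-bananification of $e$ in $G$, and for $n\ge 1$ let $G_{n+1}$ be obtained from $G_n$ by $(1,3,1)$-bananifying one of the three parallel edges created in the previous step. Then the generating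 function of the classes $\mathbb U(G_n)$ is rational, with denominator independent of $G$ and $e$: there is a polynomial $P(\rho)\in K_0(\mathcal V_K)[\rho]$, of degree at most $1$ in $\rho$, such that in $K_0(\mathcal V_K)[[\rho]]$ $$\sum_{n\ge 0}\mathbb U(G_n)\,\rho^n=\frac{P(\rho)}{1-\mathbb T(\mathbb T+1)^2(\mathbb T+2)\,\rho+2\,\mathbb T^2(\mathbb T+1)^4\,\rho^2}.$$ The numerator $P$ can be written as a polynomial in $\mathbb T$ and $\rho$ with integer coefficients if and only if $\mathbb U(G_0)$ and $\mathbb U(G_1)$ are polynomials in $\mathbb T$ with integer coefficients. Moreover, for all $n\ge 1$, $$\mathbb U(G_{n+1})=\mathbb T(\mathbb T+1)^2(\mathbb T+2)\,\mathbb U(G_n)-2\,\mathbb T^2(\mathbb T+1)^4\,\mathbb U(G_{n-1}).$$ -/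

import Mathlib

open CategoryTheory AlgebraicGeometry
open scoped Graph

universe u

/-! ### The Grothendieck ring of varieties -/

/-- A variety over `K`: a separated scheme of finite type over `Spec K`. -/
structure Variety (K : Type u) [Field K] where
  scheme : Scheme.{u}
  structureMap : scheme ⟶ Spec (CommRingCat.of K)
  isSeparated : IsSeparated structureMap
  locallyOfFiniteType : LocallyOfFiniteType structureMap
  quasiCompact : QuasiCompact structureMap

/-- The defining relations of `K₀(Var_K)`, on the free commutative ring on all varieties:
isomorphic varieties are identified, `[X] = [Y] + [X ∖ Y]` for a closed subvariety `Y` of `X`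
(`X ∖ Y` being the complementary open subvariety), `[X ×_K Y] = [X] [Y]`, and `[Spec K] = 1`.
By the last two relations every monomial in the generators is again the class of a variety, so
that the quotient is the abelian group generated by isomorphism classes of varieties with the
inclusion-exclusion relations, with the product of classes given by the product of varieties. -/
inductive GrothendieckRel (K : Type u) [Field K] :
    FreeCommRing (Variety K) → FreeCommRing (Variety K) → Prop
  | iso (X Y : Variety K) (φ : X.scheme ≅ Y.scheme)
      (hφ : φ.hom ≫ Y.structureMap = X.structureMap) :
      GrothendieckRel K (FreeCommRing.of X) (FreeCommRing.of Y)
  | scissor (X Y U : Variety K) (i : Y.scheme ⟶ X.scheme) (j : U.scheme ⟶ X.scheme)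
      (hi : i ≫ X.structureMap = Y.structureMap) (hj : j ≫ X.structureMap = U.structureMap)
      (hic : IsClosedImmersion i) (hjo : IsOpenImmersion j)
      (hU : Set.range j = (Set.range i)ᶜ) :
      GrothendieckRel K (FreeCommRing.of X) (FreeCommRing.of Y + FreeCommRing.of U)
  | prod (X Y P : Variety K) (p : P.scheme ⟶ X.scheme) (q : P.scheme ⟶ Y.scheme)
      (hP : IsPullback p q X.structureMap Y.structureMap)
      (hp : p ≫ X.structureMap = P.structureMap) :
      GrothendieckRel K (FreeCommRing.of P) (FreeCommRing.of X * FreeCommRing.of Y)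
  | point (X : Variety K) (hX : IsIso X.structureMap) :
      GrothendieckRel K (FreeCommRing.of X) 1

/-- The Grothendieck ring of varieties `K₀(Var_K)`. -/
abbrev GrothendieckRing (K : Type u) [Field K] : Type (u + 1) :=
  FreeCommRing (Variety K) ⧸ Ideal.ofRel (GrothendieckRel K)

/-- The class `[X]` of a variety in `K₀(Var_K)`. -/
noncomputable def Variety.toRing {K : Type u} [Field K] (X : Variety K) : GrothendieckRing K :=
  Ideal.Quotient.mk _ (FreeCommRing.of X)

/-- The open set `{f ≠ 0}` in the affine space `Spec K[t_i : i ∈ σ]`. -/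
noncomputable def nonvanishingLocus {K : Type u} [Field K] {σ : Type u} (f : MvPolynomial σ K) :
    (Spec (CommRingCat.of (MvPolynomial σ K))).Opens :=
  PrimeSpectrum.basicOpen f

/-- The complement `{f ≠ 0}` of the hypersurface `f = 0` in the affine space over `K` with
coordinates indexed by the finite type `σ`, as an open subscheme of `Spec K[t_i : i ∈ σ]`. -/
noncomputable def hypersurfaceComplement {K : Type u} [Field K] {σ : Type u} [Finite σ]
    (f : MvPolynomial σ K) : Variety K where
  scheme := nonvanishingLocus f
  structureMap := (nonvanishingLocus f).ι ≫
    Spec.map (CommRingCat.ofHom (MvPolynomial.C : K →+* MvPolynomial σ K))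
  isSeparated := by infer_instance
  locallyOfFiniteType := by
    have : LocallyOfFiniteType
        (Spec.map (CommRingCat.ofHom (MvPolynomial.C : K →+* MvPolynomial σ K))) := by
      rw [HasRingHomProperty.Spec_iff (P := @LocallyOfFiniteType)]
      exact (RingHom.finiteType_algebraMap (A := K) (B := MvPolynomial σ K)).mpr inferInstance
    infer_instance
  quasiCompact := by
    have : IsNoetherianRing (CommRingCat.of (MvPolynomial σ K)) :=
      inferInstanceAs (IsNoetherianRing (MvPolynomial σ K))
    infer_instance

/-- The Lefschetz motive `𝕃 = [𝔸¹]`, the affine line being `{1 ≠ 0}` in `𝔸¹`. -/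
noncomputable def lefschetz (K : Type u) [Field K] : GrothendieckRing K :=
  (hypersurfaceComplement (1 : MvPolynomial PUnit.{u + 1} K)).toRing

/-- The class `𝕋 = [𝔸¹ ∖ 𝔸⁰] = 𝕃 - 1`. -/
noncomputable def torusClass (K : Type u) [Field K] : GrothendieckRing K :=
  lefschetz K - 1

/-! ### Graphs and the Kirchhoff–Symanzik polynomial -/

namespace Graph

variable {α β : Type u}

/-- `x` and `y` are joined by a (possibly trivial) path of `G` that uses only edges in `F`. -/
def Joined (G : Graph α β) (F : Set β) : α → α → Prop :=
  Relation.ReflTransGen fun x y => ∃ f ∈ F, G.IsLink f x y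

/-- `F` is the edge set of a maximal spanning forest of `G`: it contains no cycle (the ends of an
edge of `F` are not joined by the other edges of `F`; in particular `F` contains no looping edge),
and any two vertices joined in `G` are joined in `F`. If `G` is connected, these are exactly the
edge sets of the spanning trees of `G`. -/
structure IsSpanningForest (G : Graph α β) (F : Set β) : Prop where
  subset : F ⊆ E(G)
  acyclic : ∀ f ∈ F, ∀ x y, G.IsLink f x y → ¬ G.Joined (F \ {f}) x y
  spanning : ∀ x y, G.Joined E(G) x y → G.Joined F x y

open Classical in
/-- The Kirchhoff–Symanzik polynomial `Ψ_G = ∑_F ∏_{e ∉ F} t_e`, with `F` ranging over the maximal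
spanning forests of `G`, in variables `t_e` indexed by the edges of `G`. -/
noncomputable def kirchhoffPoly (G : Graph α β) [Finite E(G)] (K : Type u) [Field K] :
    MvPolynomial E(G) K :=
  letI : Fintype E(G) := Fintype.ofFinite E(G)
  ∑ F ∈ Finset.univ.filter fun F : Finset E(G) => G.IsSpanningForest (Subtype.val '' (F : Set E(G))),
    ∏ e ∈ Fᶜ, MvPolynomial.X e

/-- The Grothendieck class `𝕌(G)`: the class of the complement of the affine graph hypersurface
`Ψ_G = 0` in the affine space with one coordinate for each edge of `G`. -/
noncomputable def grothendieckClass (G : Graph α β) [Finite E(G)] (K : Type u) [Field K] :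
    GrothendieckRing K :=
  (hypersurfaceComplement (G.kirchhoffPoly K)).toRing

/-- The ends of the five edges of a string of a `1`-banana, a `3`-banana and a `1`-banana that
joins `x` to `y` through two new vertices. -/
def stringEnds (x y : α) : Fin 5 → Sym2 (α ⊕ Bool) :=
  ![s(.inl x, .inr false), s(.inr false, .inr true), s(.inr false, .inr true),
    s(.inr false, .inr true), s(.inr true, .inl y)]

/-- The `(1,3,1)`-bananification of the edge `e` of `G`, with ends `x` and `y`: `e` is deleted, and
replaced by a string of a `1`-banana, a `3`-banana and a `1`-banana from `x` to `y`. -/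
def bananify (G : Graph α β) (e : β) (x y : α) (h : G.IsLink e x y) :
    Graph (α ⊕ Bool) (β ⊕ Fin 5) where
  vertexSet := Sum.inl '' V(G) ∪ Set.range Sum.inr
  IsLink f p q :=
    (∃ f' a b, f = .inl f' ∧ p = .inl a ∧ q = .inl b ∧ f' ≠ e ∧ G.IsLink f' a b) ∨
      ∃ i, f = .inr i ∧ s(p, q) = stringEnds x y i
  isLink_symm := by
    intro f _
    refine ⟨?_⟩
    rintro p q (⟨f', a, b, rfl, rfl, rfl, hne, hl⟩ | ⟨i, rfl, hi⟩)
    · exact .inl ⟨f', b, a, rfl, rfl, rfl, hne, hl.symm⟩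
    · exact .inr ⟨i, rfl, by rw [Sym2.eq_swap, hi]⟩
  eq_or_eq_of_isLink_of_isLink := by
    rintro f p q p' q' (⟨f', a, b, rfl, rfl, rfl, hne, hl⟩ | ⟨i, rfl, hi⟩)
      (⟨f'', a', b', hf, rfl, rfl, hne', hl'⟩ | ⟨i', hf, hi'⟩)
    · cases hf
      exact (hl.left_eq_or_eq hl').imp (congrArg _) (congrArg _)
    · cases hf
    · cases hf
    · cases hf
      rw [← hi', Sym2.eq_iff] at hi
      tauto
  left_mem_of_isLink := by
    rintro f p q (⟨f', a, b, rfl, rfl, rfl, hne, hl⟩ | ⟨i, rfl, hi⟩)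
    · exact .inl ⟨a, hl.left_mem, rfl⟩
    · have hp : p ∈ stringEnds x y i := hi ▸ Sym2.mem_mk_left p q
      have hx := h.left_mem
      have hy := h.right_mem
      fin_cases i <;> simp [stringEnds] at hp <;> rcases hp with rfl | rfl <;> simp [hx, hy]

end Graph

/-- A graph (loops and multiple edges allowed) with finitely many edges and a marked edge. -/
structure MarkedGraph where
  Vert : Type u
  Edge : Type u
  graph : Graph Vert Edge
  finite : Finite E(graph)
  edge : Edge
  edge_mem : edge ∈ E(graph)

namespace MarkedGraph

/-- Apply a `(1,3,1)`-bananification to the marked edge, and mark one of the three parallel edges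
so created. (The three are interchanged by automorphisms of the new graph, and the string is
symmetric, so the result does not depend on choices up to isomorphism.) -/
noncomputable def next (M : MarkedGraph.{u}) : MarkedGraph.{u} where
  Vert := M.Vert ⊕ Bool
  Edge := M.Edge ⊕ Fin 5
  graph := M.graph.bananify M.edge
    (M.graph.exists_isLink_of_mem_edgeSet M.edge_mem).choose
    (M.graph.exists_isLink_of_mem_edgeSet M.edge_mem).choose_spec.choose
    (M.graph.exists_isLink_of_mem_edgeSet M.edge_mem).choose_spec.choose_spec
  finite := by
    have := M.finite
    refine Set.Finite.subset (s := Sum.inl '' E(M.graph) ∪ Set.range Sum.inr)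
      ((Set.Finite.image _ this).union (Set.finite_range _)) ?_
    rintro f ⟨p, q, ⟨f', a, b, rfl, -, -, -, hl⟩ | ⟨i, rfl, -⟩⟩
    · exact .inl ⟨f', hl.edge_mem, rfl⟩
    · exact .inr ⟨i, rfl⟩
  edge := .inr 2
  edge_mem := ⟨.inr false, .inr true, .inr ⟨2, rfl, rfl⟩⟩

/-- The Grothendieck class of the underlying graph. -/
noncomputable def grothendieckClass (M : MarkedGraph.{u}) (K : Type u) [Field K] :
    GrothendieckRing K :=
  haveI := M.finite
  M.graph.grothendieckClass K

end MarkedGraph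

/-- The tower of `3`-bananas over the edge `e` of `G`: the graph `G_n` is obtained by a chain of `n`
`(1,3,1)`-bananifications, the first one applied to `e`, and each following one applied to one of
the three parallel edges created by the one before. -/
noncomputable def bananaTower {α β : Type u} (G : Graph α β) [Finite E(G)] (e : β) (he : e ∈ E(G))
    (n : ℕ) : MarkedGraph.{u} :=
  MarkedGraph.next^[n] ⟨α, β, G, inferInstance, e, he⟩

/-! ### Classes of affine varieties and of their principal open subsets. -/

namespace GrothendieckRing

section AffineClass

variable {K : Type u} [Field K]

/-! Write Ψ_G = t_e F + H with F and H free of t_e, and put q = [F ≠ 0] and p = [F = 0, H ≠ 0], the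
latter computed as [H ≠ 0] - [FH ≠ 0]. Over F ≠ 0 the polynomial Ψ_G is a coordinate on the
t_e-line, and over F = 0 it is constant along that line, so 𝕌(G) = 𝕃 p + 𝕋 q (`openClass_linear`,
`IsPresentation.grothendieckClass_eq`).

Sorting the spanning forests by their trace on the string (`isSpanningForest_bananify_iff`,
`forestSum_bananify`) shows that bananifying e turns Ψ_G into e₂ g + e₃ F. Here g = (t₀ + t₄) F + H,
the variables t₀, t₄ belong to the outer edges, and e₂, e₃ are the elementary symmetric polynomials
in the three parallel variables. Isolating one parallel variable and calling the others a, b gives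
the new pair F' = b(g + aF) + ag, H' = abg. All these expressions are built from polynomials of
degree one in a variable, so repeated use of the fibration argument yields a linear map
(`IsPresentation.exists_bananify`): p' = 𝕃²𝕋 p + 𝕃𝕋(𝕋 - 1) q and q' = 𝕃³𝕋 (p + q).

With 𝕃 = 𝕋 + 1 its trace is 𝕋(𝕋 + 1)²(𝕋 + 2) and its determinant is 2𝕋²(𝕋 + 1)⁴. By Cayley–Hamilton
every linear function of (p, q), in particular 𝕌, satisfies the recurrence. The generating function
is a formal consequence. Bridges and loops need no separate treatment: F vanishes for a bridge and H
for a loop, and the formulas persist. -/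

lemma toRing_eq_of_iso (X Y : Variety K) (φ : X.scheme ≅ Y.scheme)
    (hφ : φ.hom ≫ Y.structureMap = X.structureMap) : X.toRing = Y.toRing :=
  Ideal.Quotient.eq.2 (Ideal.subset_span ⟨_, _, .iso X Y φ hφ, by ring⟩)

lemma toRing_eq_add (X Y U : Variety K) (i : Y.scheme ⟶ X.scheme) (j : U.scheme ⟶ X.scheme)
    (hi : i ≫ X.structureMap = Y.structureMap) (hj : j ≫ X.structureMap = U.structureMap)
    (hic : IsClosedImmersion i) (hjo : IsOpenImmersion j)
    (hU : Set.range j = (Set.range i)ᶜ) : X.toRing = Y.toRing + U.toRing := by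
  rw [Variety.toRing, Variety.toRing, Variety.toRing, ← map_add]
  exact Ideal.Quotient.eq.2
    (Ideal.subset_span ⟨_, _, .scissor X Y U i j hi hj hic hjo hU, by ring⟩)

lemma toRing_eq_mul (X Y P : Variety K) (p : P.scheme ⟶ X.scheme) (q : P.scheme ⟶ Y.scheme)
    (hP : IsPullback p q X.structureMap Y.structureMap)
    (hp : p ≫ X.structureMap = P.structureMap) : P.toRing = X.toRing * Y.toRing := by
  rw [Variety.toRing, Variety.toRing, Variety.toRing, ← map_mul]
  exact Ideal.Quotient.eq.2 (Ideal.subset_span ⟨_, _, .prod X Y P p q hP hp, by ring⟩)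

variable (K)

/-- The affine variety `Spec A` of a finitely generated `K`-algebra `A`. -/
noncomputable def affineVariety (A : Type u) [CommRing A] [Algebra K A] [Algebra.FiniteType K A] :
    Variety K where
  scheme := Spec (CommRingCat.of A)
  structureMap := Spec.map (CommRingCat.ofHom (algebraMap K A))
  isSeparated := inferInstance
  locallyOfFiniteType := by
    rw [HasRingHomProperty.Spec_iff (P := @LocallyOfFiniteType)]
    exact RingHom.finiteType_algebraMap.mpr inferInstance
  quasiCompact := inferInstance

/-- The class of `Spec A`. -/
noncomputable def affineClass (A : Type u) [CommRing A] [Algebra K A] [Algebra.FiniteType K A] :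
    GrothendieckRing K :=
  (affineVariety K A).toRing

/-- The class of the open subvariety `{g ≠ 0}` of `Spec A`. -/
noncomputable def openClass {A : Type u} [CommRing A] [Algebra K A] [Algebra.FiniteType K A]
    (g : A) : GrothendieckRing K :=
  haveI : Algebra.FiniteType K (Localization.Away g) := .trans (S := A) inferInstance inferInstance
  affineClass K (Localization.Away g)

variable {A B C : Type u} [CommRing A] [Algebra K A] [Algebra.FiniteType K A]
  [CommRing B] [Algebra K B] [Algebra.FiniteType K B]
  [CommRing C] [Algebra K C] [Algebra.FiniteType K C]

lemma affineClass_congr (e : A ≃ₐ[K] B) : affineClass K A = affineClass K B := by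
  refine toRing_eq_of_iso _ _ (Scheme.Spec.mapIso e.symm.toRingEquiv.toCommRingCatIso.op) ?_
  simp only [affineVariety, Functor.mapIso_hom, Iso.op_hom, Scheme.Spec_map, Quiver.Hom.unop_op]
  rw [← Spec.map_comp]
  congr 1
  ext x
  exact e.symm.commutes x

lemma affineClass_eq_add (f : A) (π : A →ₐ[K] C) (hπ : Function.Surjective π)
    (hker : RingHom.ker π = Ideal.span {f}) [Algebra A B] [IsScalarTower K A B]
    [IsLocalization.Away f B] : affineClass K A = affineClass K C + affineClass K B := by
  refine toRing_eq_add _ _ _ (Spec.map (CommRingCat.ofHom π.toRingHom))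
    (Spec.map (CommRingCat.ofHom (algebraMap A B))) ?_ ?_
    (IsClosedImmersion.spec_of_surjective _ hπ) ?_ ?_
  · simp only [affineVariety]
    rw [← Spec.map_comp]
    congr 1
    ext x
    exact π.commutes x
  · simp only [affineVariety]
    rw [← Spec.map_comp]
    congr 1
    ext x
    exact (IsScalarTower.algebraMap_apply K A B x).symm
  · exact IsOpenImmersion.of_isLocalization f
  · refine (PrimeSpectrum.localization_away_comap_range B f).trans ?_
    refine Eq.trans ?_ (congrArg compl (range_comap_of_surjective C π.toRingHom hπ).symm)
    have : RingHom.ker π.toRingHom = Ideal.span {f} := hker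
    rw [this, PrimeSpectrum.basicOpen_eq_zeroLocus_compl, PrimeSpectrum.zeroLocus_span]
    rfl

attribute [local instance] Polynomial.algebra in
lemma affineClass_polynomial :
    affineClass K (Polynomial A) = affineClass K (Polynomial K) * affineClass K A := by
  refine toRing_eq_mul _ _ _
    (Spec.map (CommRingCat.ofHom (algebraMap (Polynomial K) (Polynomial A))))
    (Spec.map (CommRingCat.ofHom (algebraMap A (Polynomial A)))) ?_ ?_
  · exact isPullback_SpecMap_of_isPushout _ _ _ _
      (CommRingCat.isPushout_of_isPushout K (Polynomial K) A (Polynomial A))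
  · simp only [affineVariety]
    rw [← Spec.map_comp]
    congr 1
    ext x
    simp

lemma openClass_eq_affineClass (g : A) (B : Type u) [CommRing B] [Algebra K B]
    [Algebra.FiniteType K B] [Algebra A B] [IsScalarTower K A B] [IsLocalization.Away g B] :
    openClass K g = affineClass K B :=
  have : Algebra.FiniteType K (Localization.Away g) := .trans (S := A) inferInstance inferInstance
  affineClass_congr K
    ((IsLocalization.algEquiv (Submonoid.powers g) (Localization.Away g) B).restrictScalars K)

lemma openClass_one : openClass K (1 : A) = affineClass K A :=
  have : IsLocalization.Away (1 : A) A :=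
    IsLocalization.away_of_isUnit_of_bijective A isUnit_one Function.bijective_id
  openClass_eq_affineClass K 1 A

lemma openClass_mul (f g : A) [Algebra A B] [IsScalarTower K A B] [IsLocalization.Away f B] :
    openClass K (f * g) = openClass K (algebraMap A B g) := by
  let L := Localization.Away (algebraMap A B g)
  have : Algebra.FiniteType K L := .trans (S := B) inferInstance inferInstance
  have : IsLocalization.Away (f * g) L := IsLocalization.Away.mul' B L f g
  rw [openClass_eq_affineClass K (f * g) L, openClass_eq_affineClass K _ L]

/-- A repeated factor does not change where a product vanishes. -/
lemma openClass_mul_mul_self (f g : A) : openClass K (f * g * g) = openClass K (f * g) := by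
  let L := Localization.Away (f * g)
  have : Algebra.FiniteType K L := .trans (S := A) inferInstance inferInstance
  have hfg : IsUnit (algebraMap A L (f * g)) := IsLocalization.Away.algebraMap_isUnit (f * g)
  have hg : IsUnit (algebraMap A L g) := isUnit_of_dvd_unit (map_dvd _ (dvd_mul_left g f)) hfg
  have : IsLocalization.Away (f * g * g) L := IsLocalization.Away.mul_of_isUnit _ _ hg
  rw [openClass_eq_affineClass K (f * g * g) L, openClass_eq_affineClass K _ L]

lemma openClass_congr (e : A ≃ₐ[K] B) (g : A) : openClass K g = openClass K (e g) := by
  let L := Localization.Away (e g)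
  let _ : Algebra A L := ((algebraMap B L).comp (e : A →+* B)).toAlgebra
  have : IsScalarTower K A L := .of_algebraMap_eq fun x => by
    rw [RingHom.algebraMap_toAlgebra, IsScalarTower.algebraMap_apply K B L]
    simp
  have : Algebra.FiniteType K L := .trans (S := B) inferInstance inferInstance
  have : IsLocalization.Away g L := by
    have := IsLocalization.isLocalization_of_base_ringEquiv (Submonoid.powers (e g)) L
      e.symm.toRingEquiv
    rw [Submonoid.map_powers] at this
    simpa using! this
  rw [openClass_eq_affineClass K g L, openClass_eq_affineClass K _ L]

/-- The open set D(g) is cut along f = 0; `C` plays the role of A/f. -/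
lemma openClass_eq_add (f g : A) (π : A →ₐ[K] C) (hπ : Function.Surjective π)
    (hker : RingHom.ker π = Ideal.span {f}) :
    openClass K g = openClass K (π g) + openClass K (g * f) := by
  let A' := Localization.Away g
  let C' := Localization.Away (π g)
  have : Algebra.FiniteType K A' := .trans (S := A) inferInstance inferInstance
  have : Algebra.FiniteType K C' := .trans (S := C) inferInstance inferInstance
  have : IsLocalization (Submonoid.map (π : A →+* C) (Submonoid.powers g)) C' := by
    rw [Submonoid.map_powers]; exact inferInstanceAs (IsLocalization.Away (π g) C')
  let π' : A' →ₐ[K] C' := Localization.awayMapₐ π g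
  have hπ' : Function.Surjective π' :=
    IsLocalization.map_surjective_of_surjective (Submonoid.powers g) A' C' hπ
  -- Localization is exact, so the kernel is still generated by f after inverting g.
  have hker' : RingHom.ker π' = Ideal.span {algebraMap A A' f} := by
    have : IsLocalization (Submonoid.powers ((π : A →+* C) g)) C' :=
      inferInstanceAs (IsLocalization.Away (π g) C')
    have := IsLocalization.ker_map (S := A') (M := Submonoid.powers g) C' (π : A →+* C)
      (Submonoid.map_powers (π : A →+* C) g)
    have h2 : RingHom.ker (π : A →+* C) = Ideal.span {f} := hker
    rw [h2, Ideal.map_span, Set.image_singleton] at this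
    exact this
  rw [openClass_mul K (B := A') g f, openClass_eq_affineClass K g A',
    openClass_eq_affineClass K (π g) C']
  let B' := Localization.Away (algebraMap A A' f)
  have : Algebra.FiniteType K B' := .trans (S := A') inferInstance inferInstance
  rw [openClass_eq_affineClass K _ B']
  exact affineClass_eq_add K _ π' hπ' hker'

end AffineClass
end GrothendieckRing

/-! ### Eliminating a variable that occurs linearly. -/

namespace GrothendieckRing

section Elimination

open Polynomial

lemma toRing_hypersurfaceComplement {K : Type u} [Field K] {σ : Type u} [Finite σ]
    (f : MvPolynomial σ K) : (hypersurfaceComplement f).toRing = openClass K f := by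
  have : Algebra.FiniteType K (Localization.Away f) :=
    .trans (S := MvPolynomial σ K) inferInstance inferInstance
  refine toRing_eq_of_iso _ (affineVariety K (Localization.Away f))
    (basicOpenIsoSpecAway (R := CommRingCat.of (MvPolynomial σ K)) f) ?_
  simp only [affineVariety, hypersurfaceComplement]
  have h : CommRingCat.ofHom (algebraMap K (Localization.Away f)) =
      CommRingCat.ofHom (MvPolynomial.C : K →+* MvPolynomial σ K) ≫
        CommRingCat.ofHom (algebraMap (MvPolynomial σ K) (Localization.Away f)) := by
    ext x
    exact IsScalarTower.algebraMap_apply K (MvPolynomial σ K) _ x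
  rw [h, Spec.map_comp, ← Category.assoc]
  exact congrArg (· ≫ _) (basicOpenIsoSpecAway_hom_SpecMap (R := CommRingCat.of (MvPolynomial σ K)) f)

variable (K : Type u) [Field K] {A : Type u} [CommRing A] [Algebra K A] [Algebra.FiniteType K A]

lemma lefschetz_eq : lefschetz K = affineClass K K[X] := by
  rw [lefschetz, toRing_hypersurfaceComplement, openClass_one]
  exact affineClass_congr K (MvPolynomial.uniqueAlgEquiv K PUnit)

attribute [local instance] Polynomial.algebra in
lemma openClass_C (g : A) : openClass K (C g) = lefschetz K * openClass K g := by
  let B := Localization.Away g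
  have : Algebra.FiniteType K B := .trans (S := A) inferInstance inferInstance
  have : IsLocalization.Away (C g) B[X] := by
    have := Polynomial.isLocalization (Submonoid.powers g) B
    rwa [Submonoid.map_powers] at this
  rw [openClass_eq_affineClass K (C g) B[X], openClass_eq_affineClass K g B,
    affineClass_polynomial, lefschetz_eq]

/-- Both sides are the class of {f = 0, g ≠ 0}, which sees g only modulo f. -/
lemma openClass_sub_mul_eq (f g g' : A) (h : f ∣ g - g') :
    openClass K g - openClass K (g * f) = openClass K g' - openClass K (g' * f) := by
  have hs := Ideal.Quotient.mkₐ_surjective K (Ideal.span {f})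
  have hk := Ideal.Quotient.mkₐ_ker K (Ideal.span {f})
  rw [openClass_eq_add K f g _ hs hk, openClass_eq_add K f g' _ hs hk, add_sub_cancel_right,
    add_sub_cancel_right]
  congr 1
  exact Ideal.Quotient.eq.2 (Ideal.mem_span_singleton.2 h)

lemma openClass_mul_X (G : A[X]) :
    openClass K (G * X) = openClass K G - openClass K (G.eval 0) := by
  let π : A[X] →ₐ[K] A := (aeval (0 : A)).restrictScalars K
  have hπ (p : A[X]) : π p = p.eval 0 :=
    congrFun (coe_aeval_eq_eval (0 : A)) p
  have hker : RingHom.ker π = Ideal.span {X} := by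
    ext p
    rw [RingHom.mem_ker, hπ, Ideal.mem_span_singleton, X_dvd_iff, coeff_zero_eq_eval_zero]
  rw [openClass_eq_add K X G π (fun a => ⟨C a, by simp [hπ]⟩) hker, hπ]
  ring

/-- An affine change of the coordinate X carries the locus to X ≠ 0. -/
lemma openClass_linear_of_isUnit (f h : A) (hf : IsUnit f) :
    openClass K (X * C f + C h) = torusClass K * affineClass K A := by
  have := hf.invertible
  have e := openClass_congr K ((algEquivCMulXAddC f h).restrictScalars K) (X : A[X])
  have hX : (algEquivCMulXAddC f h).restrictScalars K (X : A[X]) = X * C f + C h := by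
    change algEquivCMulXAddC f h X = _
    rw [algEquivCMulXAddC_apply, aeval_X, mul_comm]
  rw [hX] at e
  have h1 := openClass_mul_X K (1 : A[X])
  rw [one_mul, eval_one, ← C_1, openClass_C, openClass_one] at h1
  rw [← e, h1, torusClass]
  ring

attribute [local instance] Polynomial.algebra in
-- Split along f. On f = 0 the polynomial is gh, constant in X, which contributes a factor 𝕃; on f ≠
-- 0 the linear factor is a coordinate, which contributes a factor 𝕋. The factor g makes it possible
-- to iterate the elimination.
lemma openClass_mul_linear (g f h : A) :
    openClass K (C g * (X * C f + C h)) =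
      lefschetz K * openClass K (g * h) + torusClass K * openClass K (g * f)
        - lefschetz K * openClass K (g * h * f) := by
  have h1 := openClass_sub_mul_eq K (C f) (C g * (X * C f + C h)) (C (g * h))
    ⟨C g * X, by simp only [C_mul]; ring⟩
  rw [← C_mul, openClass_C, openClass_C] at h1
  -- Inverting gf makes the leading coefficient f a unit.
  have h2 : openClass K (C g * (X * C f + C h) * C f) = torusClass K * openClass K (g * f) := by
    let B := Localization.Away (g * f)
    have : Algebra.FiniteType K B := .trans (S := A) inferInstance inferInstance
    have : IsLocalization.Away (C (g * f)) B[X] := by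
      have := Polynomial.isLocalization (Submonoid.powers (g * f)) B
      rwa [Submonoid.map_powers] at this
    have hu : IsUnit (algebraMap A B f) :=
      isUnit_of_dvd_unit (map_dvd _ (dvd_mul_left f g)) (IsLocalization.Away.algebraMap_isUnit (g * f))
    have := openClass_mul K (B := B[X]) (C (g * f)) (X * C f + C h)
    rw [show C g * (X * C f + C h) * C f = C (g * f) * (X * C f + C h) by
      simp only [C_mul]; ring, this, openClass_eq_affineClass K (g * f) B,
      ← openClass_linear_of_isUnit K _ (algebraMap A B h) hu]
    simp
  rw [h2] at h1
  linear_combination h1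

end Elimination
end GrothendieckRing

/-! ### Classes of the polynomials produced by series and parallel edges. -/

namespace GrothendieckRing

section Banana

open Polynomial

variable (K : Type u) [Field K] {A : Type u} [CommRing A] [Algebra K A] [Algebra.FiniteType K A]

lemma openClass_C_mul_X (g : A) : openClass K (C g * X) = torusClass K * openClass K g := by
  rw [openClass_mul_X, openClass_C, eval_C, torusClass]
  ring

lemma openClass_mul_self (g : A) : openClass K (g * g) = openClass K g := by
  simpa using openClass_mul_mul_self K 1 g

lemma openClass_linear (f h : A) :
    openClass K (X * C f + C h) = lefschetz K * openClass K h + torusClass K * openClass K f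
      - lefschetz K * openClass K (f * h) := by
  simpa [mul_comm f h] using openClass_mul_linear K 1 f h

lemma openClass_C_mul_linear_self (f h : A) :
    openClass K (C f * (X * C f + C h)) = torusClass K * openClass K f := by
  rw [openClass_mul_linear, openClass_mul_self, mul_right_comm, mul_comm (f * f),
    mul_comm f h, ← mul_assoc, openClass_mul_mul_self]
  ring

/-- Over each point with h ≠ 0 the fibre is a line, less the one root of the linear factor when f ≠
0. -/
lemma openClass_C_mul_linear_const (f h : A) :
    openClass K (C h * (X * C f + C h)) = lefschetz K * openClass K h - openClass K (f * h) := by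
  rw [openClass_mul_linear, openClass_mul_self, mul_assoc h h f, mul_comm h (h * f),
    mul_right_comm h f h, mul_comm (h * h) f, ← mul_assoc f h h, openClass_mul_mul_self,
    mul_comm h f, torusClass]
  ring

lemma openClass_C_mul_linear_mul_X (f h : A) :
    openClass K (C h * (X * C f + C h) * X) = torusClass K * openClass K h
      - openClass K (f * h) := by
  rw [openClass_mul_X, openClass_C_mul_linear_const]
  simp only [eval_mul, eval_add, eval_C, eval_X, zero_mul, zero_add, openClass_mul_self, torusClass]
  ring

variable (f h : A)

/-- `b(h + a f) + a h`, over `A[a][b]`. -/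
lemma openClass_parallel :
    openClass K (X * C (X * C f + C h) + C (C h * X)) =
      lefschetz K * torusClass K * openClass K h
        + torusClass K * (lefschetz K * openClass K h + torusClass K * openClass K f
          - lefschetz K * openClass K (f * h))
        - lefschetz K * (torusClass K * openClass K h - openClass K (f * h)) := by
  rw [openClass_linear, openClass_C_mul_X, openClass_linear, ← mul_assoc (X * C f + C h),
    mul_comm _ (C h), openClass_C_mul_linear_mul_X]
  ring

lemma openClass_C_mul_X_mul_X :
    openClass K (C (C h * X) * X) = torusClass K ^ 2 * openClass K h := by
  rw [openClass_C_mul_X, openClass_C_mul_X]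
  ring

/-- This is the correction term that turns [H' ≠ 0] into the class of {F' = 0, H' ≠ 0}. -/
lemma openClass_parallel_mul :
    openClass K ((X * C (X * C f + C h) + C (C h * X)) * (C (C h * X) * X)) =
      torusClass K ^ 2 * openClass K h - torusClass K * openClass K h + openClass K (f * h) := by
  rw [← mul_assoc, mul_comm _ (C (C h * X)), openClass_C_mul_linear_mul_X, openClass_C_mul_X,
    ← mul_assoc (X * C f + C h), mul_comm _ (C h), openClass_C_mul_linear_mul_X]
  ring

/-- `c f + (a f + h)`, over `A[a][c]`. -/
lemma openClass_series :
    openClass K (X * C (C f) + C (X * C f + C h)) = lefschetz K * (lefschetz K * openClass K h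
      + torusClass K * openClass K f - lefschetz K * openClass K (f * h)) := by
  rw [openClass_linear, openClass_C_mul_linear_self, openClass_C, openClass_linear]
  ring

lemma openClass_series_mul :
    openClass K (C (C f) * (X * C (C f) + C (X * C f + C h))) =
      lefschetz K * torusClass K * openClass K f := by
  rw [openClass_C_mul_linear_self, openClass_C]
  ring

end Banana
end GrothendieckRing

/-! ### Connectivity by a set of edges. -/

namespace Graph

section Joined

variable {α β : Type u} {G : Graph α β} {F F' : Set β} {a b c : α}

lemma Joined.refl (a : α) : G.Joined F a a := Relation.ReflTransGen.refl

lemma Joined.trans (h : G.Joined F a b) (h' : G.Joined F b c) : G.Joined F a c :=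
  Relation.ReflTransGen.trans h h'

lemma Joined.of_isLink {f : β} (hf : f ∈ F) (h : G.IsLink f a b) : G.Joined F a b :=
  Relation.ReflTransGen.single ⟨f, hf, h⟩

/-- Joinedness is the smallest equivalence relation containing the links in `F`. Choosing `r`
suitably proves invariants and separation statements without handling paths. -/
lemma Joined.of_equivalence {r : α → α → Prop} (hr : Equivalence r)
    (h : ∀ f ∈ F, ∀ a b, G.IsLink f a b → r a b) (hab : G.Joined F a b) : r a b := by
  induction hab with
  | refl => exact hr.refl _
  | tail _ hs ih =>
    obtain ⟨f, hf, hl⟩ := hs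
    exact hr.trans ih (h f hf _ _ hl)

lemma Joined.symm (h : G.Joined F a b) : G.Joined F b a := by
  induction h with
  | refl => exact .refl _
  | tail _ hs ih =>
    obtain ⟨f, hf, hl⟩ := hs
    exact (Joined.of_isLink hf hl.symm).trans ih

lemma Joined.equivalence : Equivalence (G.Joined F) := ⟨.refl, .symm, .trans⟩

lemma Joined.mono (hF : F ⊆ F') (h : G.Joined F a b) : G.Joined F' a b :=
  h.of_equivalence Joined.equivalence fun _ hf _ _ hl => .of_isLink (hF hf) hl

end Joined

/-! ### Spanning forests of a bananified graph. -/

section Bananify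

variable {α β : Type u} {G : Graph α β} {e : β} {x y : α} {h : G.IsLink e x y}
  {F : Set β} {S : Set (Fin 5)} {p q : α ⊕ Bool} {a b : α}

/-- The set of edges of a bananified graph with old part `F` and new part `S`. -/
def stringSet (F : Set β) (S : Set (Fin 5)) : Set (β ⊕ Fin 5) := Sum.inl '' F ∪ Sum.inr '' S

@[simp] lemma inl_mem_stringSet {f : β} : Sum.inl f ∈ stringSet F S ↔ f ∈ F := by simp [stringSet]

@[simp] lemma inr_mem_stringSet {i : Fin 5} : Sum.inr i ∈ stringSet F S ↔ i ∈ S := by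
  simp [stringSet]

lemma stringSet_diff_inl (f : β) : stringSet F S \ {.inl f} = stringSet (F \ {f}) S := by
  ext (g | i) <;> simp

lemma stringSet_diff_inr (i : Fin 5) : stringSet F S \ {.inr i} = stringSet F (S \ {i}) := by
  ext (g | i) <;> simp

lemma stringSet_mono {F' : Set β} {S' : Set (Fin 5)} (hF : F ⊆ F') (hS : S ⊆ S') :
    stringSet F S ⊆ stringSet F' S' :=
  Set.union_subset_union (Set.image_mono hF) (Set.image_mono hS)

/-- `S` contains one of the edges of the `3`-banana. -/
def HasMid (S : Set (Fin 5)) : Prop := 1 ∈ S ∨ 2 ∈ S ∨ 3 ∈ S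

/-- `S` contains a path joining the ends of the string. -/
def Connects (S : Set (Fin 5)) : Prop := 0 ∈ S ∧ HasMid S ∧ 4 ∈ S

lemma bananify_isLink_inl {f : β} :
    (G.bananify e x y h).IsLink (.inl f) p q ↔
      f ≠ e ∧ ∃ a b, p = .inl a ∧ q = .inl b ∧ G.IsLink f a b := by
  constructor
  · rintro (⟨f', a, b, hf, rfl, rfl, hne, hl⟩ | ⟨i, hf, -⟩)
    · cases hf
      exact ⟨hne, a, b, rfl, rfl, hl⟩
    · cases hf
  · rintro ⟨hne, a, b, rfl, rfl, hl⟩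
    exact .inl ⟨f, a, b, rfl, rfl, rfl, hne, hl⟩

lemma bananify_isLink_inr {i : Fin 5} :
    (G.bananify e x y h).IsLink (.inr i) p q ↔ s(p, q) = stringEnds x y i := by
  constructor
  · rintro (⟨f', a, b, hf, -⟩ | ⟨j, hf, hj⟩)
    · cases hf
    · cases hf
      exact hj
  · exact fun hi => .inr ⟨i, rfl, hi⟩

lemma edgeSet_bananify : E(G.bananify e x y h) = stringSet (E(G) \ {e}) Set.univ := by
  ext (f | i)
  · simp only [inl_mem_stringSet, Set.mem_sdiff, Set.mem_singleton_iff]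
    constructor
    · intro hf
      obtain ⟨p, q, hl⟩ := exists_isLink_of_mem_edgeSet hf
      obtain ⟨hne, a, b, -, -, hl⟩ := bananify_isLink_inl.1 hl
      exact ⟨hl.edge_mem, hne⟩
    · rintro ⟨hf, hne⟩
      obtain ⟨a, b, hl⟩ := exists_isLink_of_mem_edgeSet hf
      exact (bananify_isLink_inl (h := h).2 ⟨hne, a, b, rfl, rfl, hl⟩).edge_mem
  · simp only [inr_mem_stringSet, Set.mem_univ, iff_true]
    induction hs : stringEnds x y i with
    | _ p q => exact (bananify_isLink_inr (h := h).2 hs.symm).edge_mem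

lemma bananify_joined_of_equivalence {r : α ⊕ Bool → α ⊕ Bool → Prop} (hr : Equivalence r)
    (hF : ∀ f ∈ F, f ≠ e → ∀ a b, G.IsLink f a b → r (.inl a) (.inl b))
    (h0 : 0 ∈ S → r (.inl x) (.inr false)) (hm : HasMid S → r (.inr false) (.inr true))
    (h4 : 4 ∈ S → r (.inr true) (.inl y))
    (hpq : (G.bananify e x y h).Joined (stringSet F S) p q) : r p q := by
  refine hpq.of_equivalence hr ?_
  have key {p q p' q' : α ⊕ Bool} (hs : s(p, q) = s(p', q')) (hr' : r p' q') : r p q := by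
    rcases Sym2.eq_iff.1 hs with ⟨rfl, rfl⟩ | ⟨rfl, rfl⟩
    exacts [hr', hr.symm hr']
  rintro (f | i) hf p q hl
  · obtain ⟨hne, a, b, rfl, rfl, hl'⟩ := bananify_isLink_inl.1 hl
    exact hF f (by simpa using hf) hne a b hl'
  · rw [bananify_isLink_inr] at hl
    rw [inr_mem_stringSet] at hf
    fin_cases i
    · exact key hl (h0 hf)
    · exact key hl (hm (.inl hf))
    · exact key hl (hm (.inr (.inl hf)))
    · exact key hl (hm (.inr (.inr hf)))
    · exact key hl (h4 hf)

lemma joined_start (h0 : 0 ∈ S) :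
    (G.bananify e x y h).Joined (stringSet F S) (.inl x) (.inr false) :=
  .of_isLink (f := .inr 0) (by simpa) (bananify_isLink_inr.2 rfl)

lemma joined_mid (hm : HasMid S) :
    (G.bananify e x y h).Joined (stringSet F S) (.inr false) (.inr true) := by
  rcases hm with hm | hm | hm
  · exact .of_isLink (f := .inr 1) (by simpa) (bananify_isLink_inr.2 rfl)
  · exact .of_isLink (f := .inr 2) (by simpa) (bananify_isLink_inr.2 rfl)
  · exact .of_isLink (f := .inr 3) (by simpa) (bananify_isLink_inr.2 rfl)

lemma joined_end (h4 : 4 ∈ S) :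
    (G.bananify e x y h).Joined (stringSet F S) (.inr true) (.inl y) :=
  .of_isLink (f := .inr 4) (by simpa) (bananify_isLink_inr.2 rfl)

/-- Two old vertices are joined in the bananified graph iff they are joined in the old one, where
`e` may be used iff the string connects its ends. -/
lemma bananify_joined_inl_iff (he : e ∉ F) :
    (G.bananify e x y h).Joined (stringSet F S) (.inl a) (.inl b) ↔
      G.Joined (F ∪ {f | f = e ∧ Connects S}) a b := by
  classical
  constructor
  · intro hab
    -- A retraction onto the old vertices that contracts the edges of the string lying in `S`,
    -- except that a middle edge goes to the pair x, y when both outer edges are present; that is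
    -- exactly when `S` may use e.
    let ρ : α ⊕ Bool → α := Sum.elim id fun i =>
      if i then (if 0 ∈ S ∧ 4 ∉ S then x else y) else (if 0 ∈ S then x else y)
    refine bananify_joined_of_equivalence
      (r := fun p q => G.Joined (F ∪ {f | f = e ∧ Connects S}) (ρ p) (ρ q))
      ⟨fun _ => .refl _, .symm, .trans⟩ ?_ ?_ ?_ ?_ hab
    · exact fun f hf _ a b hl => .of_isLink (.inl hf) hl
    · intro h0
      simpa [ρ, h0] using Joined.refl _
    · intro hm
      by_cases h0 : 0 ∈ S
      · by_cases h4 : 4 ∈ S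
        · simpa [ρ, h0, h4] using Joined.of_isLink (.inr ⟨rfl, h0, hm, h4⟩) h
        · simpa [ρ, h0, h4] using Joined.refl _
      · simpa [ρ, h0] using Joined.refl _
    · intro h4
      simpa [ρ, h4] using Joined.refl _
  · intro hab
    refine hab.of_equivalence
      (r := fun a b => (G.bananify e x y h).Joined (stringSet F S) (.inl a) (.inl b))
      ⟨fun _ => .refl _, .symm, .trans⟩ ?_
    rintro f (hf | ⟨rfl, h0, hm, h4⟩) a b hl
    · exact .of_isLink (f := .inl f) (by simpa)
        (bananify_isLink_inl.2 ⟨fun hfe => he (hfe ▸ hf), a, b, rfl, rfl, hl⟩)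
    · have hxy := ((joined_start (h := h) (F := F) h0).trans (joined_mid hm)).trans (joined_end h4)
      rcases hl.eq_and_eq_or_eq_and_eq h with ⟨rfl, rfl⟩ | ⟨rfl, rfl⟩
      exacts [hxy, hxy.symm]

/-- Without edge 0, the first inner vertex can be reached from x only around the back, through y. -/
lemma joined_of_notMem_start (h0 : 0 ∉ S)
    (hj : (G.bananify e x y h).Joined (stringSet F S) (.inl x) (.inr false)) :
    HasMid S ∧ 4 ∈ S ∧ G.Joined F x y := by
  by_cases hS : HasMid S ∧ 4 ∈ S
  · refine ⟨hS.1, hS.2, ?_⟩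
    let ρ : α ⊕ Bool → α := Sum.elim id fun _ => y
    refine bananify_joined_of_equivalence (r := fun p q => G.Joined F (ρ p) (ρ q))
      ⟨fun _ => .refl _, .symm, .trans⟩ ?_ ?_ ?_ ?_ hj
    · exact fun f hf _ a b hl => .of_isLink hf hl
    · exact fun h => absurd h h0
    · exact fun _ => .refl _
    · exact fun _ => .refl _
  -- The string is cut on the far side as well, and `κ` marks the piece containing the first inner
  -- vertex, which meets no old vertex.
  · let κ : α ⊕ Bool → Prop := Sum.elim (fun _ => False) fun i => i → HasMid S
    have := bananify_joined_of_equivalence (r := fun p q => κ p ↔ κ q)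
      ⟨fun _ => .rfl, .symm, .trans⟩ ?_ ?_ ?_ ?_ hj
    · simp [κ] at this
    · exact fun f hf _ a b hl => .rfl
    · exact fun h => absurd h h0
    · intro hm; simpa [κ] using hm
    · intro h4; simp [κ]; tauto

lemma joined_of_notMem_end (h4 : 4 ∉ S)
    (hj : (G.bananify e x y h).Joined (stringSet F S) (.inr true) (.inl y)) :
    HasMid S ∧ 0 ∈ S ∧ G.Joined F x y := by
  by_cases hS : HasMid S ∧ 0 ∈ S
  · refine ⟨hS.1, hS.2, ?_⟩
    let ρ : α ⊕ Bool → α := Sum.elim id fun _ => x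
    refine bananify_joined_of_equivalence (r := fun p q => G.Joined F (ρ p) (ρ q))
      ⟨fun _ => .refl _, .symm, .trans⟩ ?_ ?_ ?_ ?_ hj
    · exact fun f hf _ a b hl => .of_isLink hf hl
    · exact fun _ => .refl _
    · exact fun _ => .refl _
    · exact fun h => absurd h h4
  · let κ : α ⊕ Bool → Prop := Sum.elim (fun _ => False) fun i => ¬ i → HasMid S
    have := bananify_joined_of_equivalence (r := fun p q => κ p ↔ κ q)
      ⟨fun _ => .rfl, .symm, .trans⟩ ?_ ?_ ?_ ?_ hj
    · simp [κ] at this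
    · exact fun f hf _ a b hl => .rfl
    · intro h0; simp [κ]; tauto
    · intro hm; simpa [κ] using hm
    · exact fun h => absurd h h4

lemma joined_of_not_hasMid (hm : ¬ HasMid S)
    (hj : (G.bananify e x y h).Joined (stringSet F S) (.inr false) (.inr true)) :
    0 ∈ S ∧ 4 ∈ S ∧ G.Joined F x y := by
  by_cases h0 : 0 ∈ S
  · by_cases h4 : 4 ∈ S
    · refine ⟨h0, h4, ?_⟩
      let ρ : α ⊕ Bool → α := Sum.elim id fun i => if i then y else x
      refine bananify_joined_of_equivalence (r := fun p q => G.Joined F (ρ p) (ρ q))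
        ⟨fun _ => .refl _, .symm, .trans⟩ ?_ ?_ ?_ ?_ hj
      · exact fun f hf _ a b hl => .of_isLink hf hl
      · exact fun _ => .refl _
      · exact fun h => absurd h hm
      · exact fun _ => .refl _
    -- With no middle edge and no edge 4, the second inner vertex is isolated.
    · have := bananify_joined_of_equivalence (r := fun p q => (p = .inr true ↔ q = .inr true))
        ⟨fun _ => .rfl, .symm, .trans⟩ ?_ ?_ ?_ ?_ hj
      · simp at this
      · simp
      · simp
      · exact fun h => absurd h hm
      · exact fun h => absurd h h4
  · have := bananify_joined_of_equivalence (r := fun p q => (p = .inr false ↔ q = .inr false))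
      ⟨fun _ => .rfl, .symm, .trans⟩ ?_ ?_ ?_ ?_ hj
    · simp at this
    · simp
    · exact fun h => absurd h h0
    · exact fun h => absurd h hm
    · simp

/-- `S` contains at most one edge of the `3`-banana. -/
def AtMostOneMid (S : Set (Fin 5)) : Prop :=
  ¬ (1 ∈ S ∧ 2 ∈ S) ∧ ¬ (1 ∈ S ∧ 3 ∈ S) ∧ ¬ (2 ∈ S ∧ 3 ∈ S)

/-- `S` joins both inner vertices of the string to its ends. -/
def Attaches (S : Set (Fin 5)) : Prop :=
  (0 ∈ S ∨ HasMid S ∧ 4 ∈ S) ∧ (4 ∈ S ∨ HasMid S ∧ 0 ∈ S)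

lemma exists_joined_inl (hS : Attaches S) (p : α ⊕ Bool) :
    ∃ a, (G.bananify e x y h).Joined (stringSet F S) p (.inl a) := by
  rcases p with a | _ | _
  · exact ⟨a, .refl _⟩
  · rcases hS.1 with h0 | ⟨hm, h4⟩
    · exact ⟨x, (joined_start h0).symm⟩
    · exact ⟨y, (joined_mid hm).trans (joined_end h4)⟩
  · rcases hS.2 with h4 | ⟨hm, h0⟩
    · exact ⟨y, joined_end h4⟩
    · exact ⟨x, ((joined_start h0).trans (joined_mid hm)).symm⟩

lemma edgeSet_eq_union (he : e ∈ E(G)) {S : Set (Fin 5)} (hS : Connects S) :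
    E(G) = E(G) \ {e} ∪ {f | f = e ∧ Connects S} := by
  ext f
  by_cases hf : f = e <;> simp [hf, he, hS]

lemma IsSpanningForest.of_bananify (hF : F ⊆ E(G) \ {e})
    (hB : (G.bananify e x y h).IsSpanningForest (stringSet F S)) :
    AtMostOneMid S ∧ Attaches S ∧ G.IsSpanningForest (F ∪ {f | f = e ∧ Connects S}) := by
  have heF : e ∉ F := fun he => (hF he).2 rfl
  have hu : Connects Set.univ := by simp [Connects, HasMid]
  have mid {i j : Fin 5} (hij : i ≠ j) (hi : stringEnds x y i = s(.inr false, .inr true))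
      (hj : stringEnds x y j = s(.inr false, .inr true)) : ¬ (i ∈ S ∧ j ∈ S) := fun hS =>
    hB.acyclic (.inr i) (by simpa using hS.1) _ _ (bananify_isLink_inr.2 hi.symm)
      (.of_isLink (f := .inr j) (by simpa using ⟨hS.2, hij.symm⟩)
        (bananify_isLink_inr.2 hj.symm))
  have span {p q : α ⊕ Bool}
      (hpq : (G.bananify e x y h).Joined (stringSet (E(G) \ {e}) Set.univ) p q) :
      (G.bananify e x y h).Joined (stringSet F S) p q :=
    hB.spanning p q (edgeSet_bananify ▸ hpq)
  refine ⟨⟨mid (by decide) rfl rfl, mid (by decide) rfl rfl, mid (by decide) rfl rfl⟩,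
    ⟨?_, ?_⟩, ⟨?_, ?_, ?_⟩⟩
  · by_contra! hS
    have := joined_of_notMem_start hS.1 (span (joined_start trivial))
    exact hS.2 this.1 this.2.1
  · by_contra! hS
    have := joined_of_notMem_end hS.1 (span (joined_end trivial))
    exact hS.2 this.1 this.2.1
  · rintro f (hf | ⟨rfl, -⟩)
    exacts [(hF hf).1, h.edge_mem]
  · rintro f (hf | ⟨rfl, hS⟩) a b hl hj
    · have hfe : f ≠ e := (hF hf).2
      refine hB.acyclic (.inl f) (by simpa) (.inl a) (.inl b)
        (bananify_isLink_inl.2 ⟨hfe, a, b, rfl, rfl, hl⟩) ?_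
      rw [stringSet_diff_inl, bananify_joined_inl_iff fun he => heF he.1]
      refine hj.mono ?_
      rintro g ⟨hg | hg, hgf⟩
      exacts [.inl ⟨hg, hgf⟩, .inr hg]
    -- If e closed a cycle, x and y would be joined in `F`; then `F` and the rest of the string
    -- would join the ends of edge 0.
    · have hxy : G.Joined F x y := by
        have : G.Joined F a b := hj.mono fun g hg => hg.1.resolve_right fun h' => hg.2 h'.1
        rcases hl.eq_and_eq_or_eq_and_eq h with ⟨rfl, rfl⟩ | ⟨rfl, rfl⟩
        exacts [this, this.symm]
      refine hB.acyclic (.inr 0) (by simpa using hS.1) _ _ (bananify_isLink_inr.2 rfl) ?_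
      rw [stringSet_diff_inr]
      have hm : HasMid (S \ {0}) := by simpa [HasMid] using hS.2.1
      have h4 : 4 ∈ S \ {0} := by simpa using hS.2.2
      refine Joined.trans ?_ ((joined_mid hm).trans (joined_end h4)).symm
      rw [bananify_joined_inl_iff heF]
      exact hxy.mono Set.subset_union_left
  · intro a b hab
    rw [← bananify_joined_inl_iff (h := h) heF]
    refine span ?_
    rw [bananify_joined_inl_iff (by simp), ← edgeSet_eq_union h.edge_mem hu]
    exact hab

lemma IsSpanningForest.bananify (hF : F ⊆ E(G) \ {e}) (hm : AtMostOneMid S) (hS : Attaches S)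
    (hG : G.IsSpanningForest (F ∪ {f | f = e ∧ Connects S})) :
    (G.bananify e x y h).IsSpanningForest (stringSet F S) := by
  have heF : e ∉ F := fun he => (hF he).2 rfl
  have hu : Connects Set.univ := by simp [Connects, HasMid]
  have hxy (hc : Connects S) : ¬ G.Joined F x y := fun hj =>
    hG.acyclic e (.inr ⟨rfl, hc⟩) x y h
      (hj.mono fun g hg => ⟨.inl hg, fun hge => heF (hge ▸ hg)⟩)
  have key {T : Set (β ⊕ Fin 5)} {p q p' q' : α ⊕ Bool} (hs : s(p, q) = s(p', q'))
      (hj : (G.bananify e x y h).Joined T p q) : (G.bananify e x y h).Joined T p' q' := by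
    rcases Sym2.eq_iff.1 hs with ⟨rfl, rfl⟩ | ⟨rfl, rfl⟩
    exacts [hj, hj.symm]
  have key_mid {i : Fin 5} (hi : i ∈ S) (hi' : i = 1 ∨ i = 2 ∨ i = 3)
      (hj : (G.bananify e x y h).Joined (stringSet F (S \ {i})) (.inr false) (.inr true)) :
      False := by
    have hmid : HasMid S := by
      rcases hi' with rfl | rfl | rfl
      exacts [.inl hi, .inr (.inl hi), .inr (.inr hi)]
    have := joined_of_not_hasMid ?_ hj
    · exact hxy ⟨this.1.1, hmid, this.2.1.1⟩ this.2.2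
    · unfold AtMostOneMid at hm
      rcases hi' with rfl | rfl | rfl <;> simp [HasMid] <;> tauto
  refine ⟨?_, ?_, ?_⟩
  · rw [edgeSet_bananify]
    exact stringSet_mono hF (Set.subset_univ _)
  · rintro (f | i) hf p q hl hj
    · obtain ⟨hfe, a, b, rfl, rfl, hl'⟩ := bananify_isLink_inl.1 hl
      rw [inl_mem_stringSet] at hf
      rw [stringSet_diff_inl, bananify_joined_inl_iff fun he => heF he.1] at hj
      refine hG.acyclic f (.inl hf) a b hl' (hj.mono ?_)
      rintro g (hg | hg)
      exacts [⟨.inl hg.1, hg.2⟩, ⟨.inr hg, fun hgf => hfe (hgf.symm.trans hg.1)⟩]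
    · rw [bananify_isLink_inr] at hl
      rw [inr_mem_stringSet] at hf
      rw [stringSet_diff_inr] at hj
      fin_cases i
      · have := joined_of_notMem_start (by simp) (key hl hj)
        refine hxy ⟨hf, ?_, this.2.1.1⟩ this.2.2
        simpa [HasMid] using this.1
      · exact key_mid hf (by decide) (key hl hj)
      · exact key_mid hf (by decide) (key hl hj)
      · exact key_mid hf (by decide) (key hl hj)
      · have := joined_of_notMem_end (by simp) (key hl hj)
        refine hxy ⟨this.2.1.1, ?_, hf⟩ this.2.2
        simpa [HasMid] using this.1
  · intro p q hpq
    rw [edgeSet_bananify] at hpq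
    -- Inner vertices are first moved to old ones inside the forest, so that spanning has to be
    -- tested only between old vertices.
    obtain ⟨a, ha⟩ := exists_joined_inl (G := G) (h := h) (F := F) hS p
    obtain ⟨b, hb⟩ := exists_joined_inl (G := G) (h := h) (F := F) hS q
    have hsub := stringSet_mono hF (Set.subset_univ S)
    have hab := ((ha.symm.mono hsub).trans hpq).trans (hb.mono hsub)
    rw [bananify_joined_inl_iff (by simp), ← edgeSet_eq_union h.edge_mem hu] at hab
    have := hG.spanning a b hab
    rw [← bananify_joined_inl_iff (h := h) heF] at this
    exact (ha.trans this).trans hb.symm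

/-- The string behaves like the edge e, present exactly when `S` connects its ends. The conditions
on `S` alone forbid cycles in the banana and stray inner vertices. -/
lemma isSpanningForest_bananify_iff (hF : F ⊆ E(G) \ {e}) :
    (G.bananify e x y h).IsSpanningForest (stringSet F S) ↔
      (AtMostOneMid S ∧ Attaches S) ∧
        G.IsSpanningForest (F ∪ {f | f = e ∧ Connects S}) :=
  ⟨fun hB => and_assoc.2 (hB.of_bananify hF), fun hS => hS.2.bananify hF hS.1.1 hS.1.2⟩

end Bananify

end Graph

/-! ### Forest sums and the Kirchhoff polynomial of a bananified graph. -/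

namespace Graph

section ForestSum

variable {α β : Type u} (G : Graph α β) {R : Type*} [CommRing R]

open Classical in
/-- The sum of the monomials `∏_{f ∈ Z ∖ F} t_f` over the sets `F ⊆ Z` of edges such that `F ∪ D` is a
maximal spanning forest of `G`. -/
noncomputable def forestSum (Z : Set β) [Finite Z] (D : Set β) (t : β → R) : R :=
  letI : Fintype Z := Fintype.ofFinite Z
  ∑ F ∈ Finset.univ.filter fun F : Finset Z =>
    G.IsSpanningForest (Subtype.val '' (F : Set Z) ∪ D), ∏ f ∈ Fᶜ, t f

open Classical in
lemma forestSum_eq_of_equiv {Z : Set β} [Finite Z] (D : Set β) {ι : Type*} [Fintype ι]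
    [DecidableEq ι] (ε : ι ≃ Z) (t : β → R) :
    G.forestSum Z D t =
      ∑ F : Finset ι, if G.IsSpanningForest ((fun i => (ε i : β)) '' (F : Set ι) ∪ D) then
        ∏ i ∈ Fᶜ, t (ε i) else 0 := by
  let _ : Fintype Z := Fintype.ofFinite Z
  rw [forestSum, Finset.sum_filter]
  refine (Finset.sum_equiv (Equiv.finsetCongr ε) (by simp) fun F _ => ?_).symm
  have h1 : Subtype.val '' ((Equiv.finsetCongr ε F : Finset Z) : Set Z) =
      (fun i => (ε i : β)) '' (F : Set ι) := by
    rw [Equiv.finsetCongr_apply, Finset.coe_map, Set.image_image]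
    rfl
  have h2 : (Equiv.finsetCongr ε F)ᶜ = Fᶜ.map ε.toEmbedding := by
    ext f; simp
  rw [h1, h2, Finset.prod_map]
  rfl

open Classical in
lemma forestSum_eq (Z : Set β) [Fintype Z] [DecidableEq Z] (D : Set β) (t : β → R) :
    G.forestSum Z D t =
      ∑ F : Finset Z, if G.IsSpanningForest (Subtype.val '' (F : Set Z) ∪ D) then
        ∏ i ∈ Fᶜ, t i else 0 :=
  G.forestSum_eq_of_equiv D (Equiv.refl Z) t

open Classical in
lemma forestSum_eq_sum {Z : Set β} [Finite Z] {κ ι : Type*} [Fintype κ] [Fintype ι]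
    [DecidableEq κ] [DecidableEq ι] (ε : κ ⊕ ι ≃ Z) (t : β → R) :
    G.forestSum Z ∅ t = ∑ S : Finset ι, (∑ F : Finset κ,
      if G.IsSpanningForest ((fun i => (ε (.inl i) : β)) '' (F : Set κ) ∪
        (fun i => (ε (.inr i) : β)) '' (S : Set ι)) then ∏ i ∈ Fᶜ, t (ε (.inl i)) else 0) *
      ∏ i ∈ Sᶜ, t (ε (.inr i)) := by
  rw [G.forestSum_eq_of_equiv ∅ ε, ← Finset.sumEquiv.symm.toEquiv.sum_comp,
    Fintype.sum_prod_type_right]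
  refine Finset.sum_congr rfl fun S _ => ?_
  rw [Finset.sum_mul]
  refine Finset.sum_congr rfl fun F _ => ?_
  have hc : (F.disjSum S)ᶜ = Fᶜ.disjSum Sᶜ := by
    ext (f | f) <;> simp
  have hi : (fun i => (ε i : β)) '' (F.disjSum S : Finset (κ ⊕ ι)) =
      (fun i => (ε (.inl i) : β)) '' (F : Set κ) ∪ (fun i => (ε (.inr i) : β)) '' (S : Set ι) := by
    ext f
    simp
  change (if G.IsSpanningForest ((fun i => (ε i : β)) '' (F.disjSum S : Finset (κ ⊕ ι)) ∪ ∅) then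
    ∏ i ∈ (F.disjSum S)ᶜ, t (ε i) else 0) = _
  rw [hc, hi, Set.union_empty, Finset.prod_disjSum, ite_mul, zero_mul]

lemma forestSum_congr {Z : Set β} [Finite Z] (D : Set β) {t t' : β → R}
    (h : ∀ f ∈ Z, t f = t' f) : G.forestSum Z D t = G.forestSum Z D t' :=
  Finset.sum_congr rfl fun _ _ => Finset.prod_congr rfl fun f _ => h f f.2

lemma map_forestSum {R' : Type*} [CommRing R'] (φ : R →+* R') (Z : Set β) [Finite Z] (D : Set β)
    (t : β → R) : φ (G.forestSum Z D t) = G.forestSum Z D fun f => φ (t f) := by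
  simp [forestSum]

lemma aeval_kirchhoffPoly (K : Type u) [Field K] [Algebra K R] [Finite E(G)] (t : β → R) :
    MvPolynomial.aeval (fun f : E(G) => t f) (G.kirchhoffPoly K) = G.forestSum E(G) ∅ t := by
  simp only [forestSum, kirchhoffPoly, map_sum, map_prod, MvPolynomial.aeval_X]
  exact Finset.sum_congr (by ext F; simp) fun _ _ => rfl

/-- A set with an element `e` is the set without `e` and one more element. -/
noncomputable def diffSumEquiv {Z : Set β} {e : β} (he : e ∈ Z) : ↥(Z \ {e}) ⊕ PUnit.{1} ≃ Z :=
  Equiv.ofBijective (Sum.elim (fun f => ⟨f, f.2.1⟩) fun _ => ⟨e, he⟩) <| by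
    constructor
    · rintro (⟨f, hf⟩ | _) (⟨g, hg⟩ | _) h <;> simp at h ⊢
      · exact h
      · exact hf.2 h
      · exact hg.2 h.symm
    · rintro ⟨f, hf⟩
      by_cases hfe : f = e
      · exact ⟨.inr ⟨⟩, by simp [hfe]⟩
      · exact ⟨.inl ⟨f, hf, hfe⟩, rfl⟩

/-- Deletion–contraction: forests avoiding e carry the factor t_e, the others do not. The forest
condition always refers to G itself, so a bridge or a loop merely makes one sum empty. -/
lemma forestSum_eq_add {Z : Set β} [Finite Z] {e : β} (he : e ∈ Z) (t : β → R) :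
    G.forestSum Z ∅ t =
      t e * G.forestSum (Z \ {e}) ∅ t + G.forestSum (Z \ {e}) {e} t := by
  classical
  let _ : Fintype ↥(Z \ {e}) := Fintype.ofFinite _
  rw [G.forestSum_eq_sum (diffSumEquiv he), forestSum_eq, forestSum_eq,
    show (Finset.univ : Finset (Finset PUnit.{1})) = {∅, {PUnit.unit}} by decide,
    Finset.sum_pair (by decide)]
  have hl (f : ↥(Z \ {e})) : (diffSumEquiv he (.inl f) : β) = f := rfl
  have hr (i : PUnit.{1}) : (diffSumEquiv he (.inr i) : β) = e := rfl
  simp only [hl, hr, Finset.coe_empty, Finset.coe_singleton, Set.image_empty,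
    Set.image_singleton]
  rw [mul_comm (t e)]
  congr 1
  · simp
  · rw [show ({PUnit.unit} : Finset PUnit.{1})ᶜ = ∅ by decide, Finset.prod_empty, mul_one]

variable {G} {e : β} {x y : α} {h : G.IsLink e x y}

/-- The edges of a bananified graph. -/
noncomputable def bananifyEdgeEquiv (h : G.IsLink e x y) :
    ↥(E(G) \ {e}) ⊕ Fin 5 ≃ E(G.bananify e x y h) :=
  Equiv.ofBijective (Sum.elim (fun f => ⟨.inl f, by simp [edgeSet_bananify, -Set.mem_sdiff]⟩)
      fun i => ⟨.inr i, by simp [edgeSet_bananify]⟩) <| by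
    constructor
    · rintro (f | i) (g | j) h <;> simp at h ⊢
      · exact Subtype.ext h
      · exact h
    · rintro ⟨f | i, hf⟩
      · rw [edgeSet_bananify, inl_mem_stringSet] at hf
        exact ⟨.inl ⟨f, hf⟩, rfl⟩
      · exact ⟨.inr i, rfl⟩

open Classical in
-- Of the 32 subsets of the string only ten are admissible: three connect the ends (both outer edges
-- and one middle edge), and seven do not. Their complementary monomials give the two coefficients.
lemma sum_string (w : Fin 5 → R) (a b : R) :
    ∑ S : Finset (Fin 5), (if AtMostOneMid (S : Set (Fin 5)) ∧ Attaches (S : Set (Fin 5)) then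
      if Connects (S : Set (Fin 5)) then b else a else 0) * ∏ i ∈ Sᶜ, w i =
    ((w 0 + w 4) * (w 1 * w 2 + w 1 * w 3 + w 2 * w 3) + w 1 * w 2 * w 3) * a +
      (w 1 * w 2 + w 1 * w 3 + w 2 * w 3) * b := by
  have h1 (S : Finset (Fin 5)) : ((AtMostOneMid (S : Set (Fin 5)) ∧ Attaches (S : Set (Fin 5))) ∧
      Connects (S : Set (Fin 5))) ↔
        S ∈ ({{1, 2}ᶜ, {1, 3}ᶜ, {2, 3}ᶜ} : Finset (Finset (Fin 5))) := by
    simp only [AtMostOneMid, Attaches, Connects, HasMid, Finset.mem_coe]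
    revert S
    decide
  have h2 (S : Finset (Fin 5)) : ((AtMostOneMid (S : Set (Fin 5)) ∧ Attaches (S : Set (Fin 5))) ∧
      ¬ Connects (S : Set (Fin 5))) ↔
        S ∈ ({{0, 1, 2}ᶜ, {0, 1, 3}ᶜ, {0, 2, 3}ᶜ, {4, 1, 2}ᶜ, {4, 1, 3}ᶜ, {4, 2, 3}ᶜ, {1, 2, 3}ᶜ} :
          Finset (Finset (Fin 5))) := by
    simp only [AtMostOneMid, Attaches, Connects, HasMid, Finset.mem_coe]
    revert S
    decide
  have h3 (S : Finset (Fin 5)) :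
      (if AtMostOneMid (S : Set (Fin 5)) ∧ Attaches (S : Set (Fin 5)) then
        if Connects (S : Set (Fin 5)) then b else a else 0) * ∏ i ∈ Sᶜ, w i =
      (if S ∈ ({{1, 2}ᶜ, {1, 3}ᶜ, {2, 3}ᶜ} : Finset (Finset (Fin 5))) then b * ∏ i ∈ Sᶜ, w i
        else 0) +
      if S ∈ ({{0, 1, 2}ᶜ, {0, 1, 3}ᶜ, {0, 2, 3}ᶜ, {4, 1, 2}ᶜ, {4, 1, 3}ᶜ, {4, 2, 3}ᶜ,
        {1, 2, 3}ᶜ} : Finset (Finset (Fin 5))) then a * ∏ i ∈ Sᶜ, w i else 0 := by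
    rw [← if_congr (h1 S) rfl rfl, ← if_congr (h2 S) rfl rfl]
    split_ifs <;> first | tauto | simp
  rw [Finset.sum_congr rfl fun S _ => h3 S, Finset.sum_add_distrib, Finset.sum_ite_mem,
    Finset.sum_ite_mem, Finset.univ_inter, Finset.univ_inter]
  have hp {i j : Fin 5} (h : i ≠ j) : ∏ k ∈ ({i, j} : Finset (Fin 5)), w k = w i * w j :=
    Finset.prod_pair h
  have ht {i j k : Fin 5} (h : i ≠ j) (h' : i ≠ k) (h'' : j ≠ k) :
      ∏ l ∈ ({i, j, k} : Finset (Fin 5)), w l = w i * (w j * w k) := by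
    rw [Finset.prod_insert (by simp [h, h']), hp h'']
  repeat rw [Finset.sum_insert (by decide)]
  simp only [Finset.sum_singleton, compl_compl]
  rw [hp (by decide), hp (by decide), hp (by decide), ht (by decide) (by decide) (by decide),
    ht (by decide) (by decide) (by decide), ht (by decide) (by decide) (by decide),
    ht (by decide) (by decide) (by decide), ht (by decide) (by decide) (by decide),
    ht (by decide) (by decide) (by decide), ht (by decide) (by decide) (by decide)]
  ring

lemma forestSum_bananify [Finite E(G)] [Finite E(G.bananify e x y h)] (t : β ⊕ Fin 5 → R) :
    (G.bananify e x y h).forestSum E(G.bananify e x y h) ∅ t =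
      ((t (.inr 0) + t (.inr 4)) * (t (.inr 1) * t (.inr 2) + t (.inr 1) * t (.inr 3)
          + t (.inr 2) * t (.inr 3)) + t (.inr 1) * t (.inr 2) * t (.inr 3)) *
        G.forestSum (E(G) \ {e}) ∅ (t ∘ .inl) +
      (t (.inr 1) * t (.inr 2) + t (.inr 1) * t (.inr 3) + t (.inr 2) * t (.inr 3)) *
        G.forestSum (E(G) \ {e}) {e} (t ∘ .inl) := by
  classical
  let _ : Fintype ↥(E(G) \ {e}) := Fintype.ofFinite _
  rw [forestSum_eq_sum _ (bananifyEdgeEquiv h), ← sum_string (fun i => t (.inr i))]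
  refine Finset.sum_congr rfl fun S _ => ?_
  congr 1
  have key (F : Finset ↥(E(G) \ {e})) := isSpanningForest_bananify_iff (h := h)
    (F := Subtype.val '' (F : Set ↥(E(G) \ {e}))) (S := S) (Subtype.coe_image_subset _ _)
  have hset (F : Finset ↥(E(G) \ {e})) :
      (fun i => (bananifyEdgeEquiv h (.inl i) : β ⊕ Fin 5)) '' (F : Set ↥(E(G) \ {e})) ∪
        (fun i => (bananifyEdgeEquiv h (.inr i) : β ⊕ Fin 5)) '' (S : Set (Fin 5)) =
      stringSet (Subtype.val '' (F : Set ↥(E(G) \ {e}))) S := by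
    rw [stringSet, Set.image_image]
    rfl
  simp only [hset, key]
  by_cases hS : AtMostOneMid (S : Set (Fin 5)) ∧ Attaches (S : Set (Fin 5))
  · by_cases hc : Connects (S : Set (Fin 5))
    · simp only [hS, hc, true_and, and_true, and_self, if_true, Set.ofPred_eq_eq_singleton, forestSum_eq]
      rfl
    · simp only [hS, hc, true_and, and_false, and_self, if_true, if_false, Set.ofPred_false, forestSum_eq]
      rfl
  · simp [hS]

end ForestSum

end Graph

/-! ### Coordinate presentations and the linear action on the pair (p, q). -/

namespace Graph

section Coordinates

open Polynomial GrothendieckRing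

variable {α β : Type u} (K : Type u) [Field K] {A : Type u} [CommRing A] [Algebra K A]

/-- `A` is the polynomial ring over `K` in the variables `t_f`, for `f ∈ Z`. -/
def IsCoordinates (Z : Set β) (t : β → A) : Prop :=
  ∃ φ : MvPolynomial Z K ≃ₐ[K] A, ∀ f : Z, φ (MvPolynomial.X f) = t f

variable {K}

lemma isCoordinates_X (Z : Set β) :
    IsCoordinates K Z (A := MvPolynomial Z K)
      (Function.extend Subtype.val MvPolynomial.X fun _ => 0) :=
  ⟨.refl, fun f => by rw [Subtype.val_injective.extend_apply]; rfl⟩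

/-- Adjoining the variables one at a time as iterated polynomial rings lets the one-variable
elimination formulas apply directly. -/
lemma IsCoordinates.insert {Z : Set β} {t : β → A} (ht : IsCoordinates K Z t) {e : β}
    (he : e ∉ Z) {t' : β → A[X]} (h1 : t' e = X) (h2 : ∀ f ∈ Z, t' f = C (t f)) :
    IsCoordinates K (insert e Z) t' := by
  classical
  obtain ⟨φ, hφ⟩ := ht
  let ε : ↥(Insert.insert e Z) ≃ Option Z :=
    (Equiv.Set.insert he).trans (Equiv.optionEquivSumPUnit Z).symm
  refine ⟨((MvPolynomial.renameEquiv K ε).trans (MvPolynomial.optionEquivLeft K Z)).trans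
    (Polynomial.mapAlgEquiv φ), ?_⟩
  rintro ⟨f, rfl | hf⟩
  · have : ε ⟨f, .inl rfl⟩ = none := by
      simp only [ε, Equiv.trans_apply, Equiv.Set.insert_apply_left]
      rfl
    simp [this, h1]
  · have : ε ⟨f, .inr hf⟩ = some ⟨f, hf⟩ := by
      simp only [ε, Equiv.trans_apply, Equiv.Set.insert_apply_right he ⟨f, hf⟩]
      rfl
    simp [this, h2 f hf, hφ]

lemma IsCoordinates.image {Z : Set β} {t : β → A} (ht : IsCoordinates K Z t) {γ : Type u}
    {i : β → γ} (hi : i.Injective) {t' : γ → A} (h : ∀ f ∈ Z, t' (i f) = t f) :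
    IsCoordinates K (i '' Z) t' := by
  obtain ⟨φ, hφ⟩ := ht
  refine ⟨(MvPolynomial.renameEquiv K (Equiv.Set.image i Z hi).symm).trans φ, ?_⟩
  rintro ⟨_, f, hf, rfl⟩
  have : (Equiv.Set.image i Z hi).symm ⟨i f, ⟨f, hf, rfl⟩⟩ = ⟨f, hf⟩ := by
    rw [Equiv.symm_apply_eq]; rfl
  simp [this, hφ, h f hf]

/-- `Ψ_G = t_e F + H` in the polynomial ring `A[t_e]`. -/
def IsPresentation (K : Type u) [Field K] [Algebra K A] (G : Graph α β) [Finite E(G)] (e : β)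
    (F H : A) : Prop :=
  ∃ t : β → A, IsCoordinates K (E(G) \ {e}) t ∧
    G.forestSum (E(G) \ {e}) ∅ t = F ∧ G.forestSum (E(G) \ {e}) {e} t = H

lemma forestSum_C (G : Graph α β) {Z : Set β} [Finite Z] (D : Set β) (t : β → A) :
    G.forestSum Z D (fun f => C (t f)) = C (G.forestSum Z D t) :=
  (G.map_forestSum C Z D t).symm

variable {G : Graph α β} [Finite E(G)] {e : β}

lemma forestSum_eq_linear (he : e ∈ E(G)) {t : β → A} {t' : β → A[X]} (h1 : t' e = X)
    (h2 : ∀ f ∈ E(G) \ {e}, t' f = C (t f)) :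
    G.forestSum E(G) ∅ t' = X * C (G.forestSum (E(G) \ {e}) ∅ t) +
      C (G.forestSum (E(G) \ {e}) {e} t) := by
  rw [forestSum_eq_add G he, h1, forestSum_congr G _ h2, forestSum_congr G _ h2,
    forestSum_C, forestSum_C]

lemma IsPresentation.grothendieckClass_eq [Algebra.FiniteType K A] (he : e ∈ E(G)) {F H : A}
    (hp : IsPresentation K G e F H) :
    G.grothendieckClass K = lefschetz K * openClass K H + torusClass K * openClass K F
      - lefschetz K * openClass K (F * H) := by
  classical
  obtain ⟨t, ht, rfl, rfl⟩ := hp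
  have h1 : Function.update (fun f => C (t f)) e X e = X := Function.update_self ..
  have h2 : ∀ f ∈ E(G) \ {e}, Function.update (fun f => C (t f)) e X f = C (t f) :=
    fun f hf => Function.update_of_ne hf.2 _ _
  have hc := ht.insert (fun h => h.2 rfl) h1 h2
  rw [Set.insert_sdiff_singleton, Set.insert_eq_of_mem he] at hc
  obtain ⟨φ, hφ⟩ := hc
  rw [grothendieckClass, toRing_hypersurfaceComplement, openClass_congr K φ, ← openClass_linear,
    ← forestSum_eq_linear he h1 h2, ← aeval_kirchhoffPoly G K]
  congr 1
  refine DFunLike.congr_fun (f := (φ : MvPolynomial E(G) K →ₐ[K] A[X])) ?_ _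
  ext f : 1
  simpa using hφ f

lemma exists_isPresentation (K : Type u) [Field K] (G : Graph α β) [Finite E(G)] (e : β) :
    ∃ F H : MvPolynomial ↥(E(G) \ {e}) K, IsPresentation K G e F H :=
  ⟨_, _, _, isCoordinates_X _, rfl, rfl⟩

lemma X_mul_C_add_C_inj {a b a' b' : A} (h : X * C a + C b = X * C a' + C b') :
    a = a' ∧ b = b' := by
  have h0 := congrArg (coeff · 0) h
  have h1 := congrArg (coeff · 1) h
  simp at h0 h1
  exact ⟨h1, h0⟩

omit [Finite E(G)] in
lemma edgeSet_bananify_diff {x y : α} {h : G.IsLink e x y} :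
    E(G.bananify e x y h) \ {.inr 2} =
      insert (.inr 3) (insert (.inr 1) (insert (.inr 4) (insert (.inr 0)
        (Sum.inl '' (E(G) \ {e}))))) := by
  rw [edgeSet_bananify]
  ext (f | i)
  · simp
  · fin_cases i <;> simp

lemma isPresentation_bananify {x y : α} {h : G.IsLink e x y} [Finite E(G.bananify e x y h)]
    {t : β ⊕ Fin 5 → A} (ht : IsCoordinates K
      (insert (.inr 4) (insert (.inr 0) (Sum.inl '' (E(G) \ {e})))) t) {f g : A}
    (hf : G.forestSum (E(G) \ {e}) ∅ (t ∘ .inl) = f)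
    (hg : (t (.inr 0) + t (.inr 4)) * f + G.forestSum (E(G) \ {e}) {e} (t ∘ .inl) = g) :
    IsPresentation K (G.bananify e x y h) (.inr 2)
      (X * C (X * C f + C g) + C (C g * X)) (C (C g * X) * X) := by
  -- The zeros in `t₁` and `t₂` are placeholders at edges outside the current coordinate set. Edges
  -- 1, 3, 2 receive the successive new variables.
  let t₁ : β ⊕ Fin 5 → A[X] :=
    Sum.elim (fun f => C (t (.inl f))) ![C (t (.inr 0)), X, 0, 0, C (t (.inr 4))]
  let t₂ : β ⊕ Fin 5 → A[X][X] :=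
    Sum.elim (fun f => C (C (t (.inl f)))) ![C (C (t (.inr 0))), C X, 0, X, C (C (t (.inr 4)))]
  let t₃ : β ⊕ Fin 5 → A[X][X][X] := Sum.elim (fun f => C (C (C (t (.inl f)))))
    ![C (C (C (t (.inr 0)))), C (C X), X, C X, C (C (C (t (.inr 4))))]
  have c₁ := ht.insert (e := .inr 1) (t' := t₁) (by simp) rfl (by
    rintro _ (rfl | rfl | ⟨f, -, rfl⟩) <;> rfl)
  have c₂ := c₁.insert (e := .inr 3) (t' := t₂) (by simp) rfl (by
    rintro _ (rfl | rfl | rfl | ⟨f, -, rfl⟩) <;> rfl)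
  rw [← edgeSet_bananify_diff (h := h)] at c₂
  -- Both forest sums are read off as the coefficients of the formula for the whole bananified graph
  -- in the variable of edge 2, so no second enumeration of forests is needed.
  refine ⟨t₂, c₂, X_mul_C_add_C_inj ?_⟩
  rw [← forestSum_eq_linear (t' := t₃) (by simp [edgeSet_bananify]) rfl (by
    rw [edgeSet_bananify_diff]
    rintro _ (rfl | rfl | rfl | rfl | ⟨f, -, rfl⟩) <;> rfl), forestSum_bananify]
  have hC (D : Set β) : G.forestSum (E(G) \ {e}) D (t₃ ∘ .inl) =
      C (C (C (G.forestSum (E(G) \ {e}) D (t ∘ .inl)))) := by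
    exact (forestSum_C _ _ _).trans (congrArg C ((forestSum_C _ _ _).trans
      (congrArg C (forestSum_C _ _ _))))
  rw [hC, hC, hf, ← hg]
  simp only [t₃, Sum.elim_inr, Matrix.cons_val, map_add, map_mul]
  ring

lemma exists_series_coordinates {t : β → A} (ht : IsCoordinates K (E(G) \ {e}) t)
    [Algebra.FiniteType K A] :
    ∃ (B : Type u) (_ : CommRing B) (_ : Algebra K B) (_ : Algebra.FiniteType K B)
      (t' : β ⊕ Fin 5 → B),
      IsCoordinates K (insert (.inr 4) (insert (.inr 0) (Sum.inl '' (E(G) \ {e})))) t' ∧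
      let L := lefschetz K
      let T := torusClass K
      let F := G.forestSum (E(G) \ {e}) ∅ t
      let H := G.forestSum (E(G) \ {e}) {e} t
      let f := G.forestSum (E(G) \ {e}) ∅ (t' ∘ .inl)
      let g := (t' (.inr 0) + t' (.inr 4)) * f + G.forestSum (E(G) \ {e}) {e} (t' ∘ .inl)
      openClass K f = L ^ 2 * openClass K F ∧
      openClass K g =
        L * (L * openClass K H + T * openClass K F - L * openClass K (F * H)) ∧
      openClass K (f * g) = L * T * openClass K F := by
  let t₀ : β ⊕ Fin 5 → A := Sum.elim t 0
  let t₁ : β ⊕ Fin 5 → A[X] := Sum.elim (fun f => C (t f)) fun _ => X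
  -- Only edges 0 and 4 get variables here; the zeros at the three parallel edges are never used.
  let t₂ : β ⊕ Fin 5 → A[X][X] := Sum.elim (fun f => C (C (t f))) ![C X, 0, 0, 0, X]
  have c₀ : IsCoordinates K (Sum.inl '' (E(G) \ {e})) t₀ :=
    ht.image Sum.inl_injective fun _ _ => rfl
  have c₁ := c₀.insert (e := .inr 0) (t' := t₁) (by simp) rfl (by
    rintro _ ⟨f, -, rfl⟩; rfl)
  have c₂ := c₁.insert (e := .inr 4) (t' := t₂) (by simp) rfl (by
    rintro _ (rfl | ⟨f, -, rfl⟩) <;> rfl)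
  have hC (D : Set β) : G.forestSum (E(G) \ {e}) D (t₂ ∘ .inl) =
      C (C (G.forestSum (E(G) \ {e}) D t)) := by
    exact (forestSum_C _ _ _).trans (congrArg C (forestSum_C _ _ _))
  refine ⟨A[X][X], inferInstance, inferInstance, inferInstance, t₂, c₂, ?_⟩
  intro L T F H f g
  have hf : f = C (C F) := hC ∅
  have hg : g = X * C (C F) + C (X * C F + C H) := by
    simp only [g, hf, hC, t₂, Sum.elim_inr, Matrix.cons_val, map_add, map_mul, H]
    ring
  rw [hf, hg, openClass_series, openClass_series_mul, openClass_C, openClass_C]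
  exact ⟨by ring, rfl, rfl⟩

/-- The effect of a `(1,3,1)`-bananification on the classes of the loci `F ≠ 0` and
`F = 0 ≠ H`. -/
lemma IsPresentation.exists_bananify {x y : α} {h : G.IsLink e x y}
    [hE : Finite E(G.bananify e x y h)] [Algebra.FiniteType K A] {F H : A}
    (hp : IsPresentation K G e F H) :
    ∃ (B : Type u) (_ : CommRing B) (_ : Algebra K B) (_ : Algebra.FiniteType K B) (F' H' : B),
      IsPresentation K (G.bananify e x y h) (.inr 2) F' H' ∧
      let L := lefschetz K
      let T := torusClass K
      let q := openClass K F
      let p := openClass K H - openClass K (F * H)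
      openClass K F' = L ^ 3 * T * (p + q) ∧
      openClass K H' - openClass K (F' * H') = L ^ 2 * T * p + L * T * (T - 1) * q := by
  obtain ⟨t, ht, rfl, rfl⟩ := hp
  obtain ⟨B, _, _, _, t', ht', hf, hg, hfg⟩ := exists_series_coordinates ht
  refine ⟨B[X][X], inferInstance, inferInstance, inferInstance, _, _,
    isPresentation_bananify ht' rfl rfl, ?_, ?_⟩
  all_goals
    simp only [openClass_parallel, openClass_C_mul_X_mul_X, openClass_parallel_mul, hf, hg, hfg]
    have hL : lefschetz K = torusClass K + 1 := by rw [torusClass]; ring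
    rw [hL]
    ring

end Coordinates

end Graph

/-! ### The recurrence and the generating function. -/

namespace MarkedGraph

open GrothendieckRing Graph

lemma grothendieckClass_next_next (M : MarkedGraph.{u}) (K : Type u) [Field K] :
    M.next.next.grothendieckClass K =
      torusClass K * (torusClass K + 1) ^ 2 * (torusClass K + 2) * M.next.grothendieckClass K
        - 2 * torusClass K ^ 2 * (torusClass K + 1) ^ 4 * M.grothendieckClass K := by
  have := M.finite
  have := M.next.finite
  have := M.next.next.finite
  obtain ⟨F, H, h₀⟩ := exists_isPresentation K M.graph M.edge
  obtain ⟨B, _, _, _, F', H', h₁, hq₁, hp₁⟩ := h₀.exists_bananify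
    (h := (M.graph.exists_isLink_of_mem_edgeSet M.edge_mem).choose_spec.choose_spec)
    (hE := M.next.finite)
  obtain ⟨B', _, _, _, F'', H'', h₂, hq₂, hp₂⟩ := h₁.exists_bananify
    (h := (M.next.graph.exists_isLink_of_mem_edgeSet M.next.edge_mem).choose_spec.choose_spec)
    (hE := M.next.next.finite)
  have e₀ := h₀.grothendieckClass_eq M.edge_mem
  have e₁ := h₁.grothendieckClass_eq M.next.edge_mem
  have e₂ := h₂.grothendieckClass_eq M.next.next.edge_mem
  change M.grothendieckClass K = _ at e₀
  change M.next.grothendieckClass K = _ at e₁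
  change M.next.next.grothendieckClass K = _ at e₂
  have hL : lefschetz K = torusClass K + 1 := by rw [torusClass]; ring
  simp only [hL] at *
  -- This regroups each class as 𝕃 p + 𝕋 q; after substituting the two transitions, the identity is
  -- Cayley–Hamilton for a 2 × 2 matrix.
  rw [add_sub_right_comm, ← mul_sub] at e₀ e₁ e₂
  rw [e₀, e₁, e₂, hp₂, hq₂, hp₁, hq₁]
  ring

end MarkedGraph

theorem mainTheorem2 {K : Type u} [Field K] {α β : Type u} (G : Graph α β) [Finite E(G)]
    (e : β) (he : e ∈ E(G)) :
    let T : GrothendieckRing K := torusClass K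
    let U : ℕ → GrothendieckRing K := fun n => (bananaTower G e he n).grothendieckClass K
    let D : Polynomial (GrothendieckRing K) :=
      1 - Polynomial.C (T * (T + 1) ^ 2 * (T + 2)) * Polynomial.X
        + Polynomial.C (2 * T ^ 2 * (T + 1) ^ 4) * Polynomial.X ^ 2
    (∃ P : Polynomial (GrothendieckRing K), P.natDegree ≤ 1 ∧
      (D : PowerSeries (GrothendieckRing K)) * PowerSeries.mk U = P) ∧
    ((∃ P : Polynomial (Polynomial ℤ),
        (D : PowerSeries (GrothendieckRing K)) * PowerSeries.mk U =
          (P.map (Polynomial.aeval T).toRingHom : Polynomial (GrothendieckRing K))) ↔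
      U 0 ∈ Algebra.adjoin ℤ {T} ∧ U 1 ∈ Algebra.adjoin ℤ {T}) ∧
    (∀ n : ℕ,
      U (n + 2) = T * (T + 1) ^ 2 * (T + 2) * U (n + 1) - 2 * T ^ 2 * (T + 1) ^ 4 * U n) := by
  intro T U D
  have hrec (n : ℕ) :
      U (n + 2) = T * (T + 1) ^ 2 * (T + 2) * U (n + 1) - 2 * T ^ 2 * (T + 1) ^ 4 * U n := by
    simp only [U, bananaTower, Function.iterate_succ_apply']
    exact MarkedGraph.grothendieckClass_next_next _ K
  set c₁ := T * (T + 1) ^ 2 * (T + 2) with hc₁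
  set c₂ := 2 * T ^ 2 * (T + 1) ^ 4 with hc₂
  -- The recurrence kills every coefficient from degree 2 on, so the first two classes determine the
  -- numerator.
  have hD : (D : PowerSeries (GrothendieckRing K)) * PowerSeries.mk U =
      (Polynomial.C (U 0) + Polynomial.C (U 1 - c₁ * U 0) * Polynomial.X :
        Polynomial (GrothendieckRing K)) := by
    ext n
    simp only [D, Polynomial.coe_add, Polynomial.coe_sub, Polynomial.coe_mul, Polynomial.coe_one,
      Polynomial.coe_C, Polynomial.coe_X, Polynomial.coe_pow, add_mul, sub_mul, one_mul, mul_assoc,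
      map_add, map_sub, PowerSeries.coeff_C_mul, PowerSeries.coeff_mk]
    rcases n with _ | _ | n
    · simp
    · simp [PowerSeries.coeff_succ_X_mul, pow_two, mul_assoc]
      rw [hc₁]
      ring
    · simp [PowerSeries.coeff_succ_X_mul, pow_succ, mul_assoc, hrec, PowerSeries.coeff_X]
      rw [hc₁, hc₂]
      ring
  have hmem (a : GrothendieckRing K) :
      a ∈ Algebra.adjoin ℤ {T} ↔ ∃ p : Polynomial ℤ, Polynomial.aeval T p = a := by
    rw [Algebra.adjoin_singleton_eq_range_aeval]
    rfl
  have hT : T ∈ Algebra.adjoin ℤ {T} := Algebra.self_mem_adjoin_singleton ℤ T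
  -- The numerator has coefficients U 0 and U 1 - c₁ U 0. As c₁ lies in ℤ[𝕋], these lie in ℤ[𝕋]
  -- exactly when U 0 and U 1 do.
  have hc₁mem : c₁ ∈ Algebra.adjoin ℤ {T} :=
    mul_mem (mul_mem hT (pow_mem (add_mem hT (one_mem _)) 2)) (add_mem hT (ofNat_mem _ 2))
  refine ⟨⟨_, Polynomial.natDegree_le_iff_coeff_eq_zero.2 ?_, hD⟩, ⟨?_, ?_⟩, hrec⟩
  · intro n hn
    obtain ⟨n, rfl⟩ := Nat.exists_eq_add_of_lt hn
    simp [Polynomial.coeff_C]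
  · rintro ⟨P, hP⟩
    rw [hD] at hP
    have hP := Polynomial.coe_injective _ hP
    have h0 := congrArg (Polynomial.coeff · 0) hP
    have h1 := congrArg (Polynomial.coeff · 1) hP
    simp [Polynomial.coeff_C] at h0 h1
    have m0 : U 0 ∈ Algebra.adjoin ℤ {T} := (hmem _).2 ⟨_, h0.symm⟩
    have m1 : U 1 - c₁ * U 0 ∈ Algebra.adjoin ℤ {T} := (hmem _).2 ⟨_, h1.symm⟩
    exact ⟨m0, by simpa using add_mem m1 (mul_mem hc₁mem m0)⟩
  · rintro ⟨m0, m1⟩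
    obtain ⟨p, hp⟩ := (hmem _).1 m0
    obtain ⟨q, hq⟩ := (hmem _).1 (sub_mem m1 (mul_mem hc₁mem m0))
    refine ⟨Polynomial.C p + Polynomial.C q * Polynomial.X, ?_⟩
    rw [hD]
    congr 1
    simp [hp, hq]
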